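/- Let $G$ be a finite simple undirected graph that is 2-connected, i.e. $G$ has at least three vertices, is connected, and remains connected after the deletion of any one vertex. Let $l$ be the length (number of edges) of a longest path in $G$, and let $c$ be the circumference of $G$, i.e. the length of a longest cycle in $G$. Then $$c \ge 2\sqrt{l}.$$ -/

import Mathlib

namespace SimpleGraph

variable {V : Type*}

/-- A graph is `k`-connected if it has more than `k` vertices and deleting any set of fewer
than `k` vertices leaves a connected graph. -/
def IsKVertexConnected (G : SimpleGraph V) (k : ℕ) : Prop :=
  (k : ℕ∞) < ENat.card V ∧
    ∀ X : Finset V, X.card < k → (G.induce ((X : Set V)ᶜ)).Connected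

/-- The set of lengths (numbers of edges) of paths of `G`. -/
def pathLengths (G : SimpleGraph V) : Set ℕ :=
  {n | ∃ (u v : V) (p : G.Walk u v), p.IsPath ∧ p.length = n}

/-- The set of lengths (numbers of edges) of cycles of `G`. -/
def cycleLengths (G : SimpleGraph V) : Set ℕ :=
  {n | ∃ (u : V) (p : G.Walk u u), p.IsCycle ∧ p.length = n}

/-- The length of a longest path of a finite nonempty graph. -/
noncomputable def longestPathLength (G : SimpleGraph V) : ℕ :=
  sSup G.pathLengths

/-- The circumference of a finite graph: the length of a longest cycle
(and `0` if there is no cycle). -/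
noncomputable def circumference (G : SimpleGraph V) : ℕ :=
  sSup G.cycleLengths

/-- In a finite nonempty graph `longestPathLength` is attained and is the maximum. -/
theorem isGreatest_longestPathLength [Finite V] [Nonempty V] (G : SimpleGraph V) :
    IsGreatest G.pathLengths G.longestPathLength := by
  have := Fintype.ofFinite V
  have hb : BddAbove G.pathLengths := by
    refine ⟨Fintype.card V, ?_⟩
    rintro n ⟨u, v, p, hp, rfl⟩
    exact hp.length_lt.le
  have hn : G.pathLengths.Nonempty :=
    ⟨0, Classical.arbitrary V, _, Walk.nil, Walk.IsPath.nil, rfl⟩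
  exact ⟨Nat.sSup_mem hn hb, fun n h => le_csSup hb h⟩

/-- In a finite graph that contains a cycle, `circumference` is attained and is the maximum. -/
theorem isGreatest_circumference [Finite V] (G : SimpleGraph V) (h : ¬ G.IsAcyclic) :
    IsGreatest G.cycleLengths G.circumference := by
  have := Fintype.ofFinite V
  have hb : BddAbove G.cycleLengths := by
    refine ⟨Fintype.card V, ?_⟩
    rintro n ⟨u, p, hp, rfl⟩
    have h1 := hp.support_nodup.length_le_card
    simpa using h1
  have hn : G.cycleLengths.Nonempty := by
    simp only [IsAcyclic, not_forall, not_not] at h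
    obtain ⟨u, p, hp⟩ := h
    exact ⟨_, u, p, hp, rfl⟩
  exact ⟨Nat.sSup_mem hn hb, fun n h => le_csSup hb h⟩

end SimpleGraph

/-! Take a longest path `f 0, …, f l`. Since no vertex is a cut vertex, every inner vertex of the
path is jumped by an ear. Always choosing an ear that reaches furthest gives a vine (`exists_vine`):
ear `t` runs from `A t` to `B (t + 1)`, and `B t ≤ A (t + 1)`. The overlaps `[A t, B t]` and the
gaps `[B t, A (t + 1)]` partition the path.

For `i < k ≤ m`, the ears `i, …, k - 1` and segments of the path form a cycle that contains the
overlaps `i` and `k`, all gaps between them, and at least one edge per ear (`PartialCycle.step`,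
`PartialCycle.exists_isCycle`). Adding these bounds over the nested pairs `(i, m - i)` counts every
overlap once, up to a middle one, and leads to `l ≤ h * (c - h) ≤ c ^ 2 / 4` for some integer `h`
(`four_mul_sum_le_sq`). -/

namespace SimpleGraph

variable {V : Type*} {G : SimpleGraph V} {f : ℕ → V} {l : ℕ}

/-! ### Gluing paths and closing cycles. -/

namespace Walk

/-- Two paths that meet only in their common end vertex concatenate to a path. -/
theorem IsPath.append_of_inter {u v w : V} {p : G.Walk u v} {q : G.Walk v w}
    (hp : p.IsPath) (hq : q.IsPath) (h : ∀ x ∈ p.support, x ∈ q.support → x = v) :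
    (p.append q).IsPath := by
  have hq' := hq.support_nodup
  rw [← cons_tail_support, List.nodup_cons] at hq'
  rw [isPath_def, support_append, List.nodup_append']
  refine ⟨hp.support_nodup, hq'.2, fun x hx hx' => ?_⟩
  have := h x hx (List.mem_of_mem_tail hx')
  exact hq'.1 (this ▸ hx')

/-- A path of length at least two whose ends are adjacent closes to a cycle. -/
theorem IsPath.isCycle_cons {u v : V} {p : G.Walk v u} (hp : p.IsPath) (h : G.Adj u v)
    (hl : 2 ≤ p.length) : (cons h p).IsCycle := by
  rw [show cons h p = (cons h Walk.nil).append p by simp]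
  refine IsPath.isCycle_append (by simp [cons_isPath_iff, h.ne]) hp ?_ (.inr hl)
  have hp' := hp.support_nodup
  rw [← cons_tail_support, List.nodup_cons] at hp'
  simpa using hp'.1

end Walk

/-! ### Ears of the path. -/

/-- The subgraph of `G` formed by the edges that avoid `f 0, …, f l`. -/
def outerGraph (G : SimpleGraph V) (f : ℕ → V) (l : ℕ) : SimpleGraph V where
  Adj u v := G.Adj u v ∧ (∀ i ≤ l, u ≠ f i) ∧ ∀ i ≤ l, v ≠ f i
  symm := ⟨fun _ _ h => ⟨h.1.symm, h.2.2, h.2.1⟩⟩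
  loopless := ⟨fun _ h => h.1.ne rfl⟩

theorem outerGraph_le : G.outerGraph f l ≤ G := fun _ _ h => h.1

theorem Walk.forall_ne_of_mem_support {u v w : V} (p : (G.outerGraph f l).Walk u v)
    (hu : ∀ i ≤ l, u ≠ f i) (hw : w ∈ p.support) : ∀ i ≤ l, w ≠ f i := by
  induction p with
  | nil => simp only [support_nil, List.mem_singleton] at hw; exact hw ▸ hu
  | cons h q ih =>
    rw [support_cons, List.mem_cons] at hw
    rcases hw with rfl | hw
    · exact hu
    · exact ih h.2.2 hw

/-- The vertex `w` outside `f 0, …, f l` is joined to `f z` by a path whose other vertices lie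
outside `f 0, …, f l`. -/
def OuterReach (G : SimpleGraph V) (f : ℕ → V) (l : ℕ) (w : V) (z : ℕ) : Prop :=
  ∃ v, (∀ i ≤ l, v ≠ f i) ∧ (G.outerGraph f l).Reachable w v ∧ G.Adj v (f z)

/-- `f x` and `f z` are joined by a path whose inner vertices lie outside `f 0, …, f l`. -/
def EarLink (G : SimpleGraph V) (f : ℕ → V) (l : ℕ) (x z : ℕ) : Prop :=
  G.Adj (f x) (f z) ∨ ∃ u, (∀ i ≤ l, u ≠ f i) ∧ G.Adj (f x) u ∧ OuterReach G f l u z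

/-- A linked pair is joined by an ear whose inner vertices see no more than `f x` and `f z` do. -/
theorem EarLink.exists_path {x z : ℕ} (h : EarLink G f l x z) (hx : x ≤ l) (hz : z ≤ l)
    (hne : f x ≠ f z) :
    ∃ p : G.Walk (f x) (f z), p.IsPath ∧ 1 ≤ p.length ∧ ∀ w ∈ p.support,
      w = f x ∨ w = f z ∨ ((∀ i ≤ l, w ≠ f i) ∧ OuterReach G f l w z ∧
        ∀ y, OuterReach G f l w y → EarLink G f l x y) := by
  classical
  rcases h with h | ⟨u, hu, hxu, v, hv, huv, hvz⟩
  · refine ⟨.cons h .nil, ?_, by simp, ?_⟩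
    · simp [Walk.cons_isPath_iff, hne]
    · intro w hw
      simp only [Walk.support_cons, Walk.support_nil, List.mem_cons, List.not_mem_nil,
        or_false] at hw
      tauto
  · obtain ⟨q, hq⟩ := huv.exists_isPath
    have hoff := fun w (hw : w ∈ q.support) => q.forall_ne_of_mem_support hu hw
    have hsupp : (q.mapLe outerGraph_le).support = q.support :=
      Walk.support_mapLe_eq_support ..
    have hq' : (q.mapLe outerGraph_le).IsPath := by
      rw [Walk.isPath_def, hsupp]; exact hq.support_nodup
    have h1 : ((q.mapLe outerGraph_le).concat hvz).IsPath :=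
      hq'.concat (fun hw => hoff _ (hsupp ▸ hw) z hz rfl) hvz
    have hmem : ∀ w, w ∈ ((q.mapLe outerGraph_le).concat hvz).support →
        w ∈ q.support ∨ w = f z := by
      intro w hw
      rw [Walk.support_concat, hsupp] at hw
      simpa using hw
    refine ⟨.cons hxu ((q.mapLe outerGraph_le).concat hvz), ?_, by simp, ?_⟩
    · rw [Walk.cons_isPath_iff]
      refine ⟨h1, fun hw => ?_⟩
      rcases hmem _ hw with hw | hw
      · exact hoff _ hw x hx rfl
      · exact hne hw
    · intro w hw
      rw [Walk.support_cons, List.mem_cons] at hw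
      rcases hw with hw | hw
      · exact .inl hw
      rcases hmem _ hw with hw | hw
      · refine .inr (.inr ⟨hoff _ hw, ⟨v, hv, ⟨q.dropUntil w hw⟩, hvz⟩, ?_⟩)
        rintro y ⟨v', hv', hwv', hvy⟩
        exact .inr ⟨u, hu, hxu, v', hv', .trans ⟨q.takeUntil w hw⟩ hwv', hvy⟩
      · exact .inr (.inl hw)

/-- The segment of the path from `f i` to `f j`. -/
theorem exists_segment (hinj : Set.InjOn f {i | i ≤ l}) (hadj : ∀ i < l, G.Adj (f i) (f (i + 1)))
    {i j : ℕ} (hij : i ≤ j) (hj : j ≤ l) :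
    ∃ p : G.Walk (f i) (f j), p.IsPath ∧ p.length = j - i ∧
      ∀ w ∈ p.support, ∃ k, i ≤ k ∧ k ≤ j ∧ w = f k := by
  induction j, hij using Nat.le_induction with
  | base => exact ⟨.nil, .nil, by simp, fun w hw => ⟨i, le_rfl, le_rfl, by simpa using hw⟩⟩
  | succ j hij ih =>
    obtain ⟨p, hp, hlen, hs⟩ := ih (by omega)
    refine ⟨p.concat (hadj j hj), hp.concat (fun hw => ?_) _, ?_, fun w hw => ?_⟩
    · obtain ⟨k, -, hk, he⟩ := hs _ hw
      have : j + 1 = k := hinj hj (show k ≤ l by omega) he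
      omega
    · rw [Walk.length_concat, hlen]; omega
    · rw [Walk.support_concat] at hw
      simp only [List.mem_append, List.mem_singleton] at hw
      rcases hw with hw | hw
      · obtain ⟨k, h1, h2, h3⟩ := hs _ hw
        exact ⟨k, h1, by omega, h3⟩
      · exact ⟨j + 1, by omega, le_rfl, hw⟩

/-! ### Cycles grown ear by ear. -/

/-- There is a path of length at least `n` from `f x` to `f y` that meets `f 0, …, f l` only in
`f y` and in positions up to `x`, and whose other vertices reach nothing beyond `f y`. -/
def PartialCycle (G : SimpleGraph V) (f : ℕ → V) (l x y n : ℕ) : Prop :=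
  ∃ p : G.Walk (f x) (f y), p.IsPath ∧ n ≤ p.length ∧ ∀ w ∈ p.support,
    (∃ i, (i ≤ x ∨ i = y) ∧ w = f i) ∨
      ((∀ i ≤ l, w ≠ f i) ∧ ∀ z ≤ l, OuterReach G f l w z → z ≤ y)

theorem PartialCycle.refl (x : ℕ) : PartialCycle G f l x x 0 :=
  ⟨.nil, .nil, le_rfl, fun w hw => .inl ⟨x, .inl le_rfl, by simpa using hw⟩⟩

/-- The new ear is disjoint from the earlier ones because its inner vertices reach `f b` with `y <
b`, while the old outer vertices reach nothing beyond `f y`. Maximality of `b` among the ears from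
`f x` restores this invariant for the new end. -/
theorem PartialCycle.step (hinj : Set.InjOn f {i | i ≤ l})
    (hadj : ∀ i < l, G.Adj (f i) (f (i + 1))) {x y n s b : ℕ} (h : PartialCycle G f l x y n)
    (hxy : x ≤ y) (hys : y ≤ s) (hsb : s < b) (hb : b ≤ l) (he : EarLink G f l x b)
    (hmax : ∀ z ≤ l, EarLink G f l x z → z ≤ b) :
    PartialCycle G f l s b (n + (s - y) + 1) := by
  obtain ⟨q, hq, hqn, hqs⟩ := h
  have hxb : f x ≠ f b := fun h => by
    have : x = b := hinj (show x ≤ l by omega) hb h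
    omega
  obtain ⟨e, hep, hel, hes⟩ := he.exists_path (by omega) hb hxb
  obtain ⟨r, hr, hrl, hrs⟩ := exists_segment hinj hadj hys (by omega)
  have hqe : (q.reverse.append e).IsPath := by
    refine hq.reverse.append_of_inter hep fun w hw hw' => ?_
    rw [Walk.support_reverse, List.mem_reverse] at hw
    rcases hes w hw' with h | h | ⟨hoff, hreach, -⟩
    · exact h
    · rcases hqs w hw with ⟨i, hi, hwi⟩ | ⟨hoff, -⟩
      · have : i = b := hinj (show i ≤ l by omega) hb (hwi.symm.trans h)
        omega
      · exact (hoff b hb h).elim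
    · rcases hqs w hw with ⟨i, hi, hwi⟩ | ⟨-, hz⟩
      · exact (hoff i (by omega) hwi).elim
      · have := hz b hb hreach
        omega
  have hsupp : ∀ w ∈ (q.reverse.append e).support,
      (∃ i, (i ≤ x ∨ i = y ∨ i = b) ∧ w = f i) ∨
        ((∀ i ≤ l, w ≠ f i) ∧ ∀ z ≤ l, OuterReach G f l w z → z ≤ b) := by
    intro w hw
    rw [Walk.mem_support_append_iff, Walk.support_reverse, List.mem_reverse] at hw
    rcases hw with hw | hw
    · rcases hqs w hw with ⟨i, hi, hwi⟩ | ⟨hoff, hz⟩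
      · exact .inl ⟨i, by omega, hwi⟩
      · exact .inr ⟨hoff, fun z hzl hr => (hz z hzl hr).trans (by omega)⟩
    · rcases hes w hw with h | h | ⟨hoff, -, hlink⟩
      · exact .inl ⟨x, .inl le_rfl, h⟩
      · exact .inl ⟨b, .inr (.inr rfl), h⟩
      · exact .inr ⟨hoff, fun z hzl hr => hmax z hzl (hlink z hr)⟩
  refine ⟨r.reverse.append (q.reverse.append e), ?_, ?_, ?_⟩
  · refine hr.reverse.append_of_inter hqe fun w hw hw' => ?_
    rw [Walk.support_reverse, List.mem_reverse] at hw
    obtain ⟨k, hk1, hk2, hwk⟩ := hrs w hw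
    rcases hsupp w hw' with ⟨i, hi, hwi⟩ | ⟨hoff, -⟩
    · have : k = i := hinj (show k ≤ l by omega) (show i ≤ l by omega) (hwk.symm.trans hwi)
      have : k = y := by omega
      rw [hwk, this]
    · exact (hoff k (by omega) hwk).elim
  · simp only [Walk.length_append, Walk.length_reverse]
    omega
  · intro w hw
    rw [Walk.mem_support_append_iff, Walk.support_reverse, List.mem_reverse] at hw
    rcases hw with hw | hw
    · obtain ⟨k, hk1, hk2, hwk⟩ := hrs w hw
      exact .inl ⟨k, .inl hk2, hwk⟩
    · rcases hsupp w hw with ⟨i, hi, hwi⟩ | h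
      · exact .inl ⟨i, by omega, hwi⟩
      · exact .inr h

/-- A last step that stops the segment at `f (b - 1)` leaves exactly one edge of the original path
to close the cycle. -/
theorem PartialCycle.exists_isCycle (hinj : Set.InjOn f {i | i ≤ l})
    (hadj : ∀ i < l, G.Adj (f i) (f (i + 1))) {x y n b : ℕ} (h : PartialCycle G f l x y n)
    (hxy : x ≤ y) (hyb : y < b) (hb : b ≤ l) (hn : 2 ≤ n + (b - y)) (he : EarLink G f l x b)
    (hmax : ∀ z ≤ l, EarLink G f l x z → z ≤ b) :
    ∃ (u : V) (p : G.Walk u u), p.IsCycle ∧ n + (b - y) + 1 ≤ p.length := by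
  obtain ⟨p, hp, hpl, -⟩ := h.step hinj hadj hxy (s := b - 1) (by omega) (by omega) hb he hmax
  have hba : G.Adj (f b) (f (b - 1)) := by
    have := hadj (b - 1) (by omega)
    rw [Nat.sub_add_cancel (by omega)] at this
    exact this.symm
  refine ⟨_, _, hp.isCycle_cons hba (by omega), ?_⟩
  rw [Walk.length_cons]
  omega

/-! ### The greedy vine. -/

/-- If the deletion of `f k` leaves a connected graph, some ear jumps over `f k`. -/
theorem exists_earLink (hinj : Set.InjOn f {i | i ≤ l}) {k : ℕ} (hk0 : 0 < k) (hkl : k < l)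
    (hconn : (G.induce ({f k}ᶜ : Set V)).Connected) :
    ∃ a < k, ∃ b, k < b ∧ b ≤ l ∧ EarLink G f l a b := by
  -- Invariant along a walk that avoids `f k`: it is at some `f a` with `a < k`, or on an excursion
  -- off the path that can be started from such an `f a`. The first return beyond `k` completes the
  -- ear.
  have key : ∀ (u v : ({f k}ᶜ : Set V)) (p : (G.induce ({f k}ᶜ : Set V)).Walk u v),
      (v : V) = f l → ((∃ a < k, (u : V) = f a) ∨ ((∀ i ≤ l, (u : V) ≠ f i) ∧
        ∃ a < k, ∃ u', (∀ i ≤ l, u' ≠ f i) ∧ G.Adj (f a) u' ∧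
          (G.outerGraph f l).Reachable u' u)) →
      ∃ a < k, ∃ b, k < b ∧ b ≤ l ∧ EarLink G f l a b := by
    intro u v p hv
    induction p with
    | nil =>
      rintro (⟨a, ha, h⟩ | ⟨hoff, -⟩)
      · have : a = l := hinj (show a ≤ l by omega) (show l ≤ l from le_rfl) (h.symm.trans hv)
        omega
      · exact (hoff l le_rfl hv).elim
    | @cons u w v h q ih =>
      have hadj' : G.Adj u w := h
      intro hu
      by_cases hw : ∀ i ≤ l, (w : V) ≠ f i
      · refine ih hv (.inr ⟨hw, ?_⟩)
        rcases hu with ⟨a, ha, hua⟩ | ⟨hoff, a, ha, u', hu', hau', hr⟩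
        · exact ⟨a, ha, w, hw, hua ▸ hadj', .refl _⟩
        · exact ⟨a, ha, u', hu', hau', hr.trans (Adj.reachable ⟨hadj', hoff, hw⟩)⟩
      · push Not at hw
        obtain ⟨i, hi, hwi⟩ := hw
        have hik : i ≠ k := fun h => w.2 (by rw [hwi, h]; rfl)
        rcases Nat.lt_or_gt_of_ne hik with hlt | hgt
        · exact ih hv (.inl ⟨i, hlt, hwi⟩)
        · rcases hu with ⟨a, ha, hua⟩ | ⟨hoff, a, ha, u', hu', hau', hr⟩
          · exact ⟨a, ha, i, hgt, hi, .inl (hua ▸ hwi ▸ hadj')⟩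
          · exact ⟨a, ha, i, hgt, hi, .inr ⟨u', hu', hau', u, hoff, hr, hwi ▸ hadj'⟩⟩
  have hne : ∀ i ≤ l, i ≠ k → f i ∈ ({f k}ᶜ : Set V) := fun i hi hik h =>
    hik (hinj hi hkl.le h)
  obtain ⟨p⟩ := hconn.preconnected ⟨f 0, hne 0 (by omega) (by omega)⟩
    ⟨f l, hne l le_rfl (by omega)⟩
  exact key _ _ p rfl (.inl ⟨0, hk0, rfl⟩)

/-- Among the ears that start before `f k`, one reaches furthest, and it jumps over `f k`. -/
theorem exists_furthest_earLink (hinj : Set.InjOn f {i | i ≤ l})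
    (hconn : ∀ v : V, (G.induce ({v}ᶜ : Set V)).Connected) {k : ℕ} (hk0 : 0 < k) (hkl : k < l) :
    ∃ a b, a < k ∧ k < b ∧ b ≤ l ∧ EarLink G f l a b ∧
      ∀ a' < k, ∀ z ≤ l, EarLink G f l a' z → z ≤ b := by
  classical
  obtain ⟨a, ha, b, hkb, hbl, h⟩ := exists_earLink hinj hk0 hkl (hconn (f k))
  have hP : ∃ a < k, EarLink G f l a b := ⟨a, ha, h⟩
  obtain ⟨a', ha', h'⟩ := Nat.findGreatest_spec (P := fun b => ∃ a < k, EarLink G f l a b) hbl hP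
  have hge := Nat.le_findGreatest (P := fun b => ∃ a < k, EarLink G f l a b) hbl hP
  exact ⟨a', _, ha', hkb.trans_le hge, Nat.findGreatest_le l, h',
    fun a'' ha'' z hz hl => Nat.le_findGreatest hz ⟨a'', ha'', hl⟩⟩

/-- The greedy vine on the path `f 0, …, f l`: the `t`-th ear goes from `f (A t)` to
`f (B (t + 1))`. -/
theorem exists_vine (hinj : Set.InjOn f {i | i ≤ l})
    (hconn : ∀ v : V, (G.induce ({v}ᶜ : Set V)).Connected) (hl : 2 ≤ l) :
    ∃ (m : ℕ) (A B : ℕ → ℕ), 1 ≤ m ∧ A 0 = 0 ∧ B 0 = 1 ∧ A m = l ∧ B m = l ∧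
      (∀ t < m, A t < B t) ∧ (∀ t < m, B t < B (t + 1)) ∧ (∀ t < m, B t ≤ A (t + 1)) ∧
      (∀ t < m, EarLink G f l (A t) (B (t + 1))) ∧
      ∀ t < m, ∀ z ≤ l, EarLink G f l (A t) z → z ≤ B (t + 1) := by
  classical
  have hex : ∀ k, ∃ ab : ℕ × ℕ, 0 < k → k < l → ab.1 < k ∧ k < ab.2 ∧ ab.2 ≤ l ∧
      EarLink G f l ab.1 ab.2 ∧ ∀ a' < k, ∀ z ≤ l, EarLink G f l a' z → z ≤ ab.2 := by
    intro k
    by_cases hk : 0 < k ∧ k < l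
    · obtain ⟨a, b, h⟩ := exists_furthest_earLink hinj hconn hk.1 hk.2
      exact ⟨(a, b), fun _ _ => h⟩
    · exact ⟨(0, 0), fun h1 h2 => (hk ⟨h1, h2⟩).elim⟩
  choose next hnext using hex
  let B : ℕ → ℕ := fun t => Nat.rec (motive := fun _ => ℕ) 1 (fun _ k => (next k).2) t
  have hB0 : B 0 = 1 := rfl
  have hBs : ∀ t, B (t + 1) = (next (B t)).2 := fun _ => rfl
  have hgrow : ∀ t, (∀ s < t, B s < l) → t + 1 ≤ B t ∧ B t ≤ l := by
    intro t
    induction t with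
    | zero => intro _; omega
    | succ t ih =>
      intro h
      have h1 := ih fun s hs => h s (by omega)
      have h2 := hnext (B t) (by omega) (h t (by omega))
      rw [hBs]
      omega
  have hreach : ∃ t, l ≤ B t := by
    by_contra hcon
    push Not at hcon
    have := (hgrow l fun s _ => hcon s).1
    have := hcon l
    omega
  obtain ⟨m, hlm, hlt⟩ : ∃ m, l ≤ B m ∧ ∀ t < m, B t < l :=
    ⟨_, Nat.find_spec hreach, fun t ht => not_le.1 (Nat.find_min hreach ht)⟩
  have hBm : B m = l := le_antisymm (hgrow m hlt).2 hlm
  have hm : 1 ≤ m := by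
    by_contra hcon
    have : m = 0 := by omega
    rw [this] at hBm
    omega
  have hN := fun t (ht : t < m) =>
    hnext (B t) (by have := (hgrow t fun s hs => hlt s (by omega)).1; omega) (hlt t ht)
  have hA : ∀ t < m, (if t < m then (next (B t)).1 else l) = (next (B t)).1 :=
    fun t ht => if_pos ht
  refine ⟨m, fun t => if t < m then (next (B t)).1 else l, B, hm, ?_, hB0, if_neg (lt_irrefl m),
    hBm, fun t ht => ?_, fun t ht => ?_, fun t ht => ?_, fun t ht => ?_, fun t ht => ?_⟩
  · have := (hN 0 hm).1
    simp only [hA 0 hm]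
    omega
  · simp only [hA t ht]; exact (hN t ht).1
  · exact (hN t ht).2.1
  · by_cases ht' : t + 1 < m
    · simp only [hA _ ht']
      -- If ear `t + 1` started before `B t`, it would have competed in the choice of ear `t` and
      -- could not end beyond `B (t + 1)`.
      by_contra hcon
      obtain ⟨-, h2, h3, h4, -⟩ := hN _ ht'
      have := (hN t ht).2.2.2.2 _ (not_le.1 hcon) _ h3 h4
      rw [← hBs t] at this
      omega
    · simp only [if_neg ht']; exact (hlt t ht).le
  · simp only [hA t ht]; exact (hN t ht).2.2.2.1
  · simp only [hA t ht]; exact (hN t ht).2.2.2.2 _ (hN t ht).1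

/-! ### Optimization over nested pairs. -/

/-- The optimization underlying the bound: `o` are the overlaps and `E` the accumulated gaps. -/
theorem four_mul_sum_le_sq {m : ℕ} {o E : ℕ → ℤ} {c : ℤ} (hm : 1 ≤ m) (ho0 : o 0 = 0)
    (hom : o m = 0) (hE0 : E 0 = 0) (hE : ∀ i j, i ≤ j → j ≤ m → E i ≤ E j)
    (hEm : 2 ≤ m → 2 ≤ E m)
    (hc : ∀ i k, i < k → k ≤ m → o i + o k + (E k - E i) + (k - i) ≤ c) :
    4 * (E m + ∑ t ∈ Finset.range m, o t) ≤ c ^ 2 := by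
  -- The outermost pair `(0, m)` supplies `E m`; the inner pairs need only that `E` is monotone. The
  -- last summand is the sum of `m - 2 * i` over `i ≤ h`.
  have hpair : ∀ h : ℕ, 2 * (h + 1) ≤ m + 1 →
      ∑ i ∈ Finset.range (h + 1), (o i + o (m - i)) + E m + ((h + 1) * m - (h + 1) * h)
        ≤ (h + 1) * c := by
    intro h
    induction h with
    | zero =>
      intro _
      have := hc 0 m (by omega) le_rfl
      simp [ho0, hom, hE0] at this ⊢
      linarith
    | succ h ih =>
      intro hh
      have h1 := ih (by omega)
      have h2 := hc (h + 1) (m - (h + 1)) (by omega) (by omega)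
      have h3 := hE (h + 1) (m - (h + 1)) (by omega) (by omega)
      rw [Finset.sum_range_succ]
      rw [Nat.cast_sub (show h + 1 ≤ m by omega)] at h2
      push_cast at h2 ⊢
      nlinarith
  have hrefl : ∀ h : ℕ, h ≤ m + 1 → ∑ i ∈ Finset.range h, o (m - i)
      = ∑ i ∈ Finset.Ico (m + 1 - h) (m + 1), o i := by
    intro h hh
    rw [Finset.range_eq_Ico, Finset.sum_Ico_reflect _ _ hh]
    simp
  have hsum : ∑ t ∈ Finset.range m, o t = ∑ t ∈ Finset.range (m + 1), o t := by
    rw [Finset.sum_range_succ, hom, add_zero]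
  rcases Nat.even_or_odd' m with ⟨h, hh | hh⟩
  · obtain ⟨h, rfl⟩ : ∃ k, h = k + 1 := ⟨h - 1, by omega⟩
    have h1 := hpair h (by omega)
    rw [Finset.sum_add_distrib, hrefl _ (by omega)] at h1
    -- For even `m` the middle overlap has no partner. Averaging the bounds for its pairs with `0`
    -- and `m`, and using `2 ≤ E m`, gives `o (h + 1) ≤ c - (h + 2)`.
    have h2 := hc 0 (h + 1) (by omega) (by omega)
    have h3 := hc (h + 1) m (by omega) le_rfl
    have h4 := hEm (by omega)
    have h5 := Finset.sum_range_add_sum_Ico o (show h + 1 + 1 ≤ m + 1 by omega)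
    rw [Finset.sum_range_succ] at h5
    rw [show m + 1 - (h + 1) = h + 1 + 1 by omega] at h1
    rw [hsum]
    have hmz : (m : ℤ) = 2 * (h + 1) := by exact_mod_cast hh
    rw [hmz] at h1 h3
    push_cast at h1 h2 h3
    nlinarith [sq_nonneg (c - 2 * (h + 2))]
  · have h1 := hpair h (by omega)
    rw [Finset.sum_add_distrib, hrefl _ (by omega)] at h1
    have h5 := Finset.sum_range_add_sum_Ico o (show h + 1 ≤ m + 1 by omega)
    rw [show m + 1 - (h + 1) = h + 1 by omega] at h1
    rw [hsum]
    have hmz : (m : ℤ) = 2 * h + 1 := by exact_mod_cast hh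
    rw [hmz] at h1
    nlinarith [sq_nonneg (c - 2 * (h + 1))]

/-! ### From the vine to the bound. -/

/-- A path of length `l ≥ 2` in a graph without cut vertices forces a cycle of length `≥ 2√l`. -/
theorem four_mul_le_sq_of_path (hinj : Set.InjOn f {i | i ≤ l})
    (hadj : ∀ i < l, G.Adj (f i) (f (i + 1)))
    (hconn : ∀ v : V, (G.induce ({v}ᶜ : Set V)).Connected) (hl : 2 ≤ l) {c : ℕ}
    (hc : ∀ (u : V) (p : G.Walk u u), p.IsCycle → p.length ≤ c) : 4 * l ≤ c ^ 2 := by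
  obtain ⟨m, A, B, hm, hA0, hB0, hAm, hBm, hAB, hBB, hBA, hlink, hmax⟩ :=
    exists_vine hinj hconn hl
  have hBl : ∀ t ≤ m, B t ≤ l := by
    intro t ht
    induction ht using Nat.decreasingInduction with
    | self => exact hBm.le
    | @of_succ t ht ih => exact (hBB t ht).le.trans ih
  let D : ℕ → ℤ := fun k => ∑ t ∈ Finset.range k, ((A (t + 1) : ℤ) - B t)
  have hD : ∀ k, D (k + 1) = D k + ((A (k + 1) : ℤ) - B k) := fun k => Finset.sum_range_succ _ _
  have hDmono : ∀ i j, i ≤ j → j ≤ m → D i ≤ D j := by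
    intro i j hij
    induction j, hij using Nat.le_induction with
    | base => exact fun _ => le_rfl
    | succ j hij ih =>
      intro hj
      have := hBA j hj
      have := ih (by omega)
      have := hD j
      omega
  have hpart : ∀ i j, i < j → j < m → ∃ n : ℕ, PartialCycle G f l (A j) (B j) n ∧ 1 ≤ n ∧
      (n : ℤ) = ((B i : ℤ) - A i) + (D j - D i) + (j - i) := by
    intro i j hij
    induction j, (show i + 1 ≤ j from hij) using Nat.le_induction with
    | base =>
      intro hj
      have h1 := hAB i (by omega)
      have h2 := hBA i (by omega)
      refine ⟨_, (PartialCycle.refl (A i)).step hinj hadj le_rfl (by omega) (hAB _ hj)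
        (hBl _ hj.le) (hlink i (by omega)) (hmax i (by omega)), by omega, ?_⟩
      have := hD i
      push_cast
      rw [Nat.cast_sub (by omega)]
      omega
    | succ j hij' ih =>
      intro hj
      obtain ⟨n, hn, hn1, hnl⟩ := ih (by omega) (by omega)
      have h2 := hBA j (by omega)
      refine ⟨_, hn.step hinj hadj (hAB j (by omega)).le h2 (hAB _ hj)
        (hBl _ hj.le) (hlink j (by omega)) (hmax j (by omega)), by omega, ?_⟩
      have := hD j
      push_cast
      rw [Nat.cast_sub (by omega)]
      omega
  have hcyc : ∀ i k, i < k → k ≤ m →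
      ((B i : ℤ) - A i) + ((B k : ℤ) - A k) + (D k - D i) + (k - i) ≤ c := by
    intro i k hik hk
    obtain ⟨j, rfl⟩ : ∃ j, k = j + 1 := ⟨k - 1, by omega⟩
    have hDj := hD j
    have hBBj := hBB j hk
    rcases Nat.lt_or_ge i j with hij | hij
    · obtain ⟨n, hn, hn1, hnl⟩ := hpart i j hij hk
      obtain ⟨u, p, hp, hpl⟩ := hn.exists_isCycle hinj hadj (hAB j hk).le hBBj (hBl _ hk)
        (by omega) (hlink j hk) (hmax j hk)
      have := hc u p hp
      push_cast
      omega
    · obtain rfl : i = j := by omega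
      have hABi := hAB i hk
      obtain ⟨u, p, hp, hpl⟩ := (PartialCycle.refl (A i)).exists_isCycle hinj hadj le_rfl
        (hABi.trans hBBj) (hBl _ hk) (by omega) (hlink i hk) (hmax i hk)
      have := hc u p hp
      push_cast
      omega
  have hDB : ∀ k, D k = (B k : ℤ) - 1 - ∑ t ∈ Finset.range k, ((B (t + 1) : ℤ) - A (t + 1)) := by
    intro k
    induction k with
    | zero => simp [D, hB0]
    | succ k ih => rw [hD, ih, Finset.sum_range_succ]; ring
  have hD0 : D 0 = 0 := rfl
  -- The initial overlap `B 0 - A 0 = 1` is moved from `o 0` into `E`. With the last gap, which is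
  -- at least 1, this yields `2 ≤ E m`.
  have hmain := four_mul_sum_le_sq (m := m) (c := (c : ℤ))
    (o := fun t => if t = 0 then 0 else (B t : ℤ) - A t)
    (E := fun t => if t = 0 then 0 else D t + 1) hm (by simp)
    (by simp [hAm, hBm]) (by simp)
    (fun i j hij hj => by
      have h0 := hDmono 0 j (by omega) hj
      have h1 := hDmono i j hij hj
      split_ifs <;> omega)
    (fun hm2 => by
      obtain ⟨k, rfl⟩ : ∃ k, m = k + 1 := ⟨m - 1, by omega⟩
      have h0 := hDmono 0 k (by omega) (by omega)
      have h1 := hD k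
      have h2 := hBB k (by omega)
      rw [if_neg (by omega)]
      omega)
    (fun i k hik hk => by
      have h := hcyc i k hik hk
      rw [if_neg (show k ≠ 0 by omega), if_neg (show k ≠ 0 by omega)]
      split_ifs with hi
      · subst hi
        rw [hD0] at h
        omega
      · omega)
  obtain ⟨k, rfl⟩ : ∃ k, m = k + 1 := ⟨m - 1, by omega⟩
  have hlast := hDB (k + 1)
  rw [Finset.sum_range_succ, hAm, hBm] at hlast
  rw [if_neg (by omega), Finset.sum_range_succ'] at hmain
  simp only [Nat.add_eq_zero_iff, one_ne_zero, and_false, if_false, if_true] at hmain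
  have : (4 * l : ℤ) ≤ (c : ℤ) ^ 2 := by linarith
  exact_mod_cast this

theorem IsKVertexConnected.connected_compl_singleton (hG : G.IsKVertexConnected 2) (v : V) :
    (G.induce ({v}ᶜ : Set V)).Connected := by
  have := hG.2 {v} (by simp)
  rwa [Finset.coe_singleton] at this

/-- In a 2-connected graph every vertex `a` has a neighbour other than a given `b ≠ a`. -/
theorem IsKVertexConnected.exists_adj_ne (hG : G.IsKVertexConnected 2) {a b : V} (hab : a ≠ b) :
    ∃ u, G.Adj u a ∧ u ≠ b := by
  obtain ⟨w, hwa, hwb⟩ : ∃ w, w ≠ a ∧ w ≠ b := by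
    by_contra hcon
    push Not at hcon
    have h := hG.1
    have huniv : (Set.univ : Set V) ⊆ {a, b} := fun w _ => by
      by_cases hw : w = a
      · exact .inl hw
      · exact .inr (hcon w hw)
    have h2 := (Set.encard_le_encard huniv).trans (Set.encard_pair hab).le
    rw [Set.encard_univ] at h2
    exact absurd h2 (not_le.2 h)
  obtain ⟨p⟩ := (hG.connected_compl_singleton b).preconnected ⟨a, hab⟩ ⟨w, hwb⟩
  cases p with
  | nil => exact (hwa rfl).elim
  | @cons _ u _ h q => exact ⟨u, Adj.symm h, u.2⟩

end SimpleGraph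

open SimpleGraph in
theorem mainTheorem2 {V : Type*} [Finite V] (G : SimpleGraph V)
    (hG : G.IsKVertexConnected 2) :
    2 * Real.sqrt (G.longestPathLength : ℝ) ≤ (G.circumference : ℝ) := by
  have hne : Nonempty V := by
    by_contra hcon
    rw [not_nonempty_iff] at hcon
    have := hG.1
    rw [ENat.card_eq_zero_iff_empty V |>.2 hcon] at this
    exact not_lt_zero this
  obtain ⟨⟨u, v, p, hp, hpl⟩, hmax⟩ := G.isGreatest_longestPathLength
  have hl0 : G.longestPathLength = 0 ∨ 2 ≤ G.longestPathLength := by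
    by_contra hcon
    have h1 : p.length = 1 := by omega
    have huv : G.Adj u v := Walk.adj_of_length_eq_one h1
    obtain ⟨w, hwu, hwv⟩ := hG.exists_adj_ne huv.ne
    have h2 := hmax ⟨w, v, .cons hwu (.cons huv .nil), by
      simp [Walk.cons_isPath_iff, huv.ne, hwu.ne, hwv], rfl⟩
    simp only [Walk.length_cons, Walk.length_nil] at h2
    omega
  rcases hl0 with hl0 | hl2
  · simp [hl0]
  have hmain : 4 * G.longestPathLength ≤ G.circumference ^ 2 :=
    four_mul_le_sq_of_path (f := p.getVert) (hpl ▸ hp.getVert_injOn)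
      (fun i hi => p.adj_getVert_succ (hpl ▸ hi)) hG.connected_compl_singleton hl2
      fun w q hq => (G.isGreatest_circumference fun h => h q hq).2 ⟨w, q, hq, rfl⟩
  have hR : (4 : ℝ) * G.longestPathLength ≤ (G.circumference : ℝ) ^ 2 := by exact_mod_cast hmain
  have h4 : Real.sqrt (G.longestPathLength : ℝ) ≤ (G.circumference : ℝ) / 2 := by
    rw [Real.sqrt_le_left (by positivity)]
    linarith
  linarith
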